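/- Let $(A,\mathfrak m)$ be a (commutative, Noetherian) Cohen--Macaulay local ring of dimension $d\ge 1$. For a maximal Cohen--Macaulay (MCM) $A$-module $X$ (finitely generated, and zero or with $\operatorname{depth} X=d$) put $$e^T_A(X)=\lim_{n\to\infty}\frac{(d-1)!}{n^{d-1}}\,\ell\bigl(\operatorname{Tor}^A_1(X,A/\mathfrak m^{n+1})\bigr).$$ Let $M,N$ be MCM $A$-modules. If $\alpha\in\operatorname{Ext}^1_A(M,N)$ is the class of an extension $0\to N\to E\to M\to 0$ (then $E$ is again MCM), put $e^T_A(\alpha)=e^T_A(M)+e^T_A(N)-e^T_A(E)$, and let $$T_A(M,N)=\{\alpha\in\operatorname{Ext}^1_A(M,N) : e^T_A(\alpha)=0\}.$$ Then $T_A(M,N)$ is an $A$-submodule of $\operatorname{Ext}^1_A(M,N)$, and the quotient $\operatorname{Ext}^1_A(M,N)/T_A(M,N)$ has finite length. -/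

import Mathlib

open CategoryTheory Filter Topology

universe u

noncomputable section

namespace TSplit

/-- The depth of a module over a local ring: the supremum of the lengths of the `M`-regular
sequences contained in the maximal ideal. (With this definition the zero module has depth `0`;
it is treated separately in `IsMCM`.) -/
def depth (A : Type u) [CommRing A] [IsLocalRing A] (M : Type u) [AddCommGroup M] [Module A M] :
    ℕ∞ :=
  ⨆ (rs : List A) (_ : ∀ r ∈ rs, r ∈ IsLocalRing.maximalIdeal A)
    (_ : RingTheory.Sequence.IsRegular M rs), (rs.length : ℕ∞)

/-- A Cohen-Macaulay local ring: a Noetherian local ring whose depth is its Krull dimension. -/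
def IsCohenMacaulay (A : Type u) [CommRing A] [IsLocalRing A] : Prop :=
  IsNoetherianRing A ∧ (depth A A : WithBot ℕ∞) = ringKrullDim A

/-- Maximal Cohen-Macaulay modules: finitely generated modules `M` with `depth M = dim A`;
the zero module is admitted. -/
def IsMCM (A : Type u) [CommRing A] [IsLocalRing A] (M : Type u) [AddCommGroup M] [Module A M] :
    Prop :=
  Module.Finite A M ∧ (Subsingleton M ∨ (depth A M : WithBot ℕ∞) = ringKrullDim A)

/-- The Krull dimension of `A` as a natural number (meaningful when it is finite, as it is for
Noetherian local rings). -/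
def dim (A : Type u) [CommRing A] : ℕ := ((ringKrullDim A).unbotD 0).toNat

/-- `ℓ(Tor₁(M, A/𝔪ⁿ⁺¹))`. -/
def torLength (A : Type u) [CommRing A] [IsLocalRing A] (M : ModuleCat.{u} A) (n : ℕ) : ℕ :=
  (Module.length A
    (((Tor (ModuleCat.{u} A) 1).obj M).obj
      (ModuleCat.of A (A ⧸ IsLocalRing.maximalIdeal A ^ (n + 1))))).toNat

/-- `HasET A M e` says that the limit
`lim_{n → ∞} (d-1)!/n^(d-1) · ℓ(Tor₁(M, A/𝔪ⁿ⁺¹))`, `d = dim A`, exists and equals `e`,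
i.e. that `e^T_A(M) = e`. -/
def HasET (A : Type u) [CommRing A] [IsLocalRing A] (M : ModuleCat.{u} A) (e : ℝ) : Prop :=
  Tendsto
    (fun n : ℕ =>
      ((dim A - 1).factorial : ℝ) / (n : ℝ) ^ (dim A - 1) * (torLength A M n : ℝ))
    atTop (𝓝 e)

/-- A class `α ∈ Ext¹(M, N)` is `T`-split if it is the class of a short exact sequence
`0 → N → E → M → 0` with `e^T(M) + e^T(N) - e^T(E) = 0`. (Two sequences with the same class have
isomorphic middle terms, and every class comes from such a sequence.) -/
def IsTSplit {A : Type u} [CommRing A] [IsLocalRing A] {M N : ModuleCat.{u} A}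
    (α : Abelian.Ext.{u} M N 1) : Prop :=
  ∃ (E : ModuleCat.{u} A) (f : N ⟶ E) (g : E ⟶ M) (w : f ≫ g = 0)
    (hS : (ShortComplex.mk f g w).ShortExact),
    hS.extClass = α ∧
      ∃ eM eN eE : ℝ, HasET A M eM ∧ HasET A N eN ∧ HasET A E eE ∧ eM + eN - eE = 0

end TSplit

end

/-!
Let `0 → L → F → M → 0` be a free presentation. Every class in `Ext¹(M, N)` is the pushout
`0 → N → E → M → 0` of this presentation along some `φ : L → N`. With `I = 𝔪ⁿ⁺¹`, the snake lemma
expresses the defect `ℓ Tor₁(M, A/I) + ℓ Tor₁(N, A/I) - ℓ Tor₁(E, A/I)` as the sum of the lengths of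
`ker (N ⊗ Q → E ⊗ Q)` for `Q = I` and `Q = A/I`, and each of these kernels is the image under
`φ ⊗ Q` of the fixed module `ker (L ⊗ Q → F ⊗ Q)`. So the defect is subadditive in `φ` and does not
increase under scalars, and the `φ` with defect `o(nᵈ⁻¹)` form a submodule whose image is the set of
`T`-split classes. By Artin–Rees a single power of `𝔪` kills all of these kernels, hence it
multiplies `Ext¹(M, N)` into that image.

The limits exist because `ℓ Tor₁(M, A/𝔪ⁿ) = ℓ((𝔪ⁿF ∩ L)/𝔪ⁿL)` is eventually polynomial in `n`
(Hilbert–Serre), of degree less than `d`: by Artin–Rees it is at most `h(n) - h(n - k)`, where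
`h(n) = ℓ(L/𝔪ⁿL)` is eventually polynomial of degree at most `d`.
-/

noncomputable section

namespace TSplit

open TensorProduct

/-! ### Eventually polynomial sequences -/

section EventuallyPoly

open Polynomial

lemma taylor_one_bernoulli_sub (K : Type*) [Field K] [CharZero K] (n : ℕ) :
    taylor 1 ((Polynomial.bernoulli (n + 1)).map (algebraMap ℚ K)) -
      (Polynomial.bernoulli (n + 1)).map (algebraMap ℚ K) = (n + 1 : K) • X ^ n := by
  have h := congrArg (Polynomial.map (algebraMap ℚ K)) (bernoulli_comp_one_add_X (n + 1))
  rw [taylor_apply, C_1, sub_eq_iff_eq_add', add_comm X 1]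
  simpa [Polynomial.map_comp, smul_eq_C_mul] using h

lemma exists_taylor_one_sub_eq {K : Type*} [Field K] [CharZero K] {r : ℕ} {P : K[X]}
    (hP : P.degree < r) : ∃ S : K[X], S.degree < (r + 1 : ℕ) ∧ taylor 1 S - S = P := by
  have hB (n : ℕ) : ((Polynomial.bernoulli n).map (algebraMap ℚ K)).degree ≤ n := by
    refine (degree_le_iff_coeff_zero _ _).2 fun m hm => ?_
    rw [coeff_map, coeff_bernoulli, if_neg (by exact_mod_cast hm.not_ge), map_zero]
  refine ⟨∑ m ∈ Finset.range r,
    (P.coeff m / (m + 1)) • (Polynomial.bernoulli (m + 1)).map (algebraMap ℚ K), ?_, ?_⟩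
  · refine (degree_sum_le _ _).trans_lt ((Finset.sup_lt_iff (WithBot.bot_lt_coe _)).2
      fun m hm => (degree_smul_le _ _).trans_lt ((hB _).trans_lt ?_))
    exact_mod_cast Nat.succ_lt_succ (Finset.mem_range.1 hm)
  · have hsum : P = ∑ m ∈ Finset.range r, P.coeff m • X ^ m := by
      ext n
      simpa [coeff_X_pow] using fun hn =>
        coeff_eq_zero_of_degree_lt (hP.trans_le (by exact_mod_cast hn))
    conv_rhs => rw [hsum]
    rw [map_sum, ← Finset.sum_sub_distrib]
    refine Finset.sum_congr rfl fun m _ => ?_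
    have hm : (m + 1 : K) ≠ 0 := by exact_mod_cast m.succ_ne_zero
    rw [map_smul, ← smul_sub, taylor_one_bernoulli_sub, smul_smul, div_mul_cancel₀ _ hm]

lemma degree_sub_taylor_lt {R : Type*} [CommRing R] {P : R[X]} {r : ℕ}
    (hP : P.degree < (r + 1 : ℕ)) (a : R) : (P - taylor a P).degree < r := by
  rcases eq_or_ne P 0 with rfl | h0
  · simp
  · refine (degree_sub_lt_left (degree_taylor P a).symm h0 (by simp)).trans_le ?_
    exact natDegree_le_iff_degree_le.1 (Nat.lt_succ_iff.1 ((natDegree_lt_iff_degree_lt h0).2 hP))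

lemma degree_le_of_eventually_le {P Q : ℝ[X]}
    (h₀ : ∀ᶠ n : ℕ in atTop, 0 ≤ P.eval (n : ℝ))
    (h : ∀ᶠ n : ℕ in atTop, P.eval (n : ℝ) ≤ Q.eval (n : ℝ)) : P.degree ≤ Q.degree := by
  by_contra! hlt
  have hP : P ≠ 0 := by rintro rfl; simp at hlt
  have hcast := tendsto_natCast_atTop_atTop (R := ℝ)
  have hroot := hcast.eventually (eventually_atTop_not_isRoot P hP)
  have hdiv := (div_tendsto_atTop_zero_of_degree_lt Q P hlt).comp hcast
  obtain ⟨n, h1, h2, h3, h4⟩ :=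
    ((hdiv.eventually (gt_mem_nhds one_pos)).and (h₀.and (h.and hroot))).exists
  have hpos : 0 < P.eval (n : ℝ) := lt_of_le_of_ne h2 (Ne.symm h4)
  exact h3.not_gt ((div_lt_one hpos).1 h1)

/-- The sequence `f` agrees for large `n` with a polynomial of degree less than `r`. -/
def IsEventuallyPoly (r : ℕ) (f : ℕ → ℝ) : Prop :=
  ∃ P : ℝ[X], P.degree < r ∧ ∀ᶠ n : ℕ in atTop, f n = P.eval (n : ℝ)

namespace IsEventuallyPoly

variable {r s : ℕ} {f g : ℕ → ℝ}

lemma zero (h : ∀ᶠ n in atTop, f n = 0) : IsEventuallyPoly r f :=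
  ⟨0, by simp, by simpa using h⟩

lemma sub (hf : IsEventuallyPoly r f) (hg : IsEventuallyPoly r g) :
    IsEventuallyPoly r fun n => f n - g n := by
  obtain ⟨P, hP, hfP⟩ := hf
  obtain ⟨Q, hQ, hgQ⟩ := hg
  refine ⟨P - Q, (degree_sub_le P Q).trans_lt (max_lt hP hQ), ?_⟩
  filter_upwards [hfP, hgQ] with n hn hn'
  rw [hn, hn', eval_sub]

lemma comp_add (hf : IsEventuallyPoly r f) (k : ℕ) : IsEventuallyPoly r fun n => f (n + k) := by
  obtain ⟨P, hP, hfP⟩ := hf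
  refine ⟨taylor (k : ℝ) P, by rwa [degree_taylor], ?_⟩
  filter_upwards [(tendsto_add_atTop_nat k).eventually hfP] with n hn
  rw [hn, taylor_eval, Nat.cast_add]

lemma of_succ_sub (h : IsEventuallyPoly r fun n => f (n + 1) - f n) :
    IsEventuallyPoly (r + 1) f := by
  obtain ⟨P, hP, hfP⟩ := h
  obtain ⟨S, hS, rfl⟩ := exists_taylor_one_sub_eq hP
  obtain ⟨n₀, hn₀⟩ := eventually_atTop.1 hfP
  refine ⟨S + C (f n₀ - S.eval (n₀ : ℝ)), ?_, eventually_atTop.2 ⟨n₀, fun n hn => ?_⟩⟩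
  · exact (degree_add_le _ _).trans_lt
      (max_lt hS (degree_C_le.trans_lt (by exact_mod_cast r.succ_pos)))
  · induction n, hn using Nat.le_induction with
    | base => simp
    | succ n hn ih =>
      have := hn₀ n hn
      simp only [eval_sub, eval_add, eval_C, taylor_eval] at this ih ⊢
      push_cast
      linarith

lemma sub_comp_sub (hf : IsEventuallyPoly (r + 1) f) (k : ℕ) :
    IsEventuallyPoly r fun n => f n - f (n - k) := by
  obtain ⟨P, hP, hfP⟩ := hf
  refine ⟨P - taylor (-k : ℝ) P, degree_sub_taylor_lt hP _, ?_⟩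
  filter_upwards [hfP, (tendsto_sub_atTop_nat k).eventually hfP, eventually_ge_atTop k]
    with n hn hnk hkn
  rw [hn, hnk, eval_sub, taylor_eval, Nat.cast_sub hkn, sub_eq_add_neg (n : ℝ)]

lemma of_le (hf : IsEventuallyPoly s f) (hg : IsEventuallyPoly r g)
    (h₀ : ∀ᶠ n in atTop, 0 ≤ f n) (h : ∀ᶠ n in atTop, f n ≤ g n) : IsEventuallyPoly r f := by
  obtain ⟨P, -, hfP⟩ := hf
  obtain ⟨Q, hQ, hgQ⟩ := hg
  refine ⟨P, (degree_le_of_eventually_le ?_ ?_).trans_lt hQ, hfP⟩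
  · filter_upwards [hfP, h₀] with n hn hn₀
    rwa [← hn]
  · filter_upwards [hfP, hgQ, h] with n hn hn' hle
    rwa [← hn, ← hn']

lemma exists_tendsto_div_pow (hf : IsEventuallyPoly (r + 1) f) :
    ∃ e, Tendsto (fun n : ℕ => f n / (n : ℝ) ^ r) atTop (𝓝 e) := by
  obtain ⟨P, hP, hfP⟩ := hf
  suffices ∃ e, Tendsto (fun x : ℝ => P.eval x / (X ^ r : ℝ[X]).eval x) atTop (𝓝 e) by
    obtain ⟨e, he⟩ := this
    refine ⟨e, (he.comp (tendsto_natCast_atTop_atTop (R := ℝ))).congr' ?_⟩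
    filter_upwards [hfP] with n hn
    rw [Function.comp_apply, eval_X_pow, hn]
  have hle : P.degree ≤ r := degree_le_iff_coeff_zero P r |>.2 fun m hm =>
    (degree_lt_iff_coeff_zero P _).1 hP m (by exact_mod_cast hm)
  rcases hle.eq_or_lt with h | h
  · exact ⟨_, div_tendsto_atTop_leadingCoeff_div_of_degree_eq P (X ^ r) (by simpa using h)⟩
  · exact ⟨_, div_tendsto_atTop_zero_of_degree_lt P (X ^ r) (by simpa using h)⟩

end IsEventuallyPoly

end EventuallyPoly

section RelLength

variable {R M M' : Type*} [CommRing R] [AddCommGroup M] [Module R M] [AddCommGroup M'] [Module R M']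

lemma length_le_of_le {p q : Submodule R M} (h : p ≤ q) : Module.length R p ≤ Module.length R q :=
  Module.length_le_of_injective (Submodule.inclusion h) (Submodule.inclusion_injective h)

lemma length_eq_length_ker_add_length_range (f : M →ₗ[R] M') :
    Module.length R M = Module.length R (LinearMap.ker f) + Module.length R (LinearMap.range f) :=
  Module.length_eq_add_of_exact (LinearMap.ker f).subtype f.rangeRestrict
    (Submodule.subtype_injective _) f.surjective_rangeRestrict
    (by rw [LinearMap.exact_iff, LinearMap.ker_rangeRestrict, Submodule.range_subtype])

lemma length_eq_length_inf_ker_add_length_map (f : M →ₗ[R] M') (q : Submodule R M) :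
    Module.length R q =
      Module.length R (q ⊓ LinearMap.ker f : Submodule R M) + Module.length R (q.map f) := by
  rw [length_eq_length_ker_add_length_range (f.domRestrict q), LinearMap.range_domRestrict,
    LinearMap.ker_domRestrict, ← Submodule.map_comap_subtype,
    (Submodule.equivSubtypeMap q _).length_eq]

/-- The length of `q / (p ⊓ q)`, realised as the image of `q` in `M / p`. -/
def relLength (p q : Submodule R M) : ℕ∞ := Module.length R (q.map p.mkQ)

lemma relLength_eq_zero_of_le {p q : Submodule R M} (h : q ≤ p) : relLength p q = 0 := by
  rw [relLength, le_bot_iff.1 ((Submodule.map_mono h).trans_eq p.mkQ_map_self), Module.length_bot]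

lemma relLength_bot (q : Submodule R M) : relLength ⊥ q = Module.length R q :=
  (Submodule.equivMapOfInjective _ (LinearMap.ker_eq_bot.1 (by simp)) q).length_eq.symm

lemma relLength_sup_left (p q : Submodule R M) : relLength p (p ⊔ q) = relLength p q := by
  rw [relLength, Submodule.map_sup, Submodule.mkQ_map_self, bot_sup_eq, relLength]

lemma relLength_mono_right (p : Submodule R M) {q q' : Submodule R M} (h : q ≤ q') :
    relLength p q ≤ relLength p q' :=
  length_le_of_le (Submodule.map_mono h)

lemma relLength_eq_add {f : M →ₗ[R] M'} {p : Submodule R M} {p' : Submodule R M'}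
    (h : p ≤ p'.comap f) (q : Submodule R M) :
    relLength p q = relLength p (q ⊓ p'.comap f) + relLength p' (q.map f) := by
  have hker : (q ⊓ p'.comap f).map p.mkQ = q.map p.mkQ ⊓ LinearMap.ker (p.mapQ p' f h) := by
    rw [Submodule.map_inf_eq_map_inf_comap, ← LinearMap.ker_comp, Submodule.mapQ_mkQ,
      LinearMap.ker_comp, Submodule.ker_mkQ]
  rw [relLength, length_eq_length_inf_ker_add_length_map (p.mapQ p' f h), ← hker,
    ← Submodule.map_comp, Submodule.mapQ_mkQ, Submodule.map_comp, relLength, relLength]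

lemma relLength_comap (f : M →ₗ[R] M') (p' : Submodule R M') (q : Submodule R M) :
    relLength (p'.comap f) q = relLength p' (q.map f) := by
  rw [relLength_eq_add le_rfl, relLength_eq_zero_of_le inf_le_right, zero_add]

lemma relLength_add {p q s : Submodule R M} (hpq : p ≤ q) (hqs : q ≤ s) :
    relLength p s = relLength p q + relLength q s := by
  have h := relLength_eq_add (f := LinearMap.id) (p' := q) (by simpa using hpq) s
  rwa [Submodule.comap_id, Submodule.map_id, inf_eq_right.2 hqs] at h

lemma relLength_anti_left {p p' : Submodule R M} (h : p ≤ p') (q : Submodule R M) :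
    relLength p' q ≤ relLength p q := by
  have hadd := relLength_eq_add (f := LinearMap.id) (p' := p') (by simpa using h) q
  rw [Submodule.map_id] at hadd
  exact hadd ▸ le_add_self

end RelLength

/-! ### Hilbert–Serre -/

section HilbertSerre

variable {R M : Type*} [CommRing R] [AddCommGroup M] [Module R M] {I : Ideal R}

/-- The filtration `{v ∈ G n | x v ∈ F (n + 1)}`: relative to `F n`, it is the kernel of
multiplication by `x` on the associated graded module of `G / F`. -/
def kerFiltration (F G : I.Filtration M) (x : R) : I.Filtration M where
  N n := G.N n ⊓ (F.N (n + 1)).comap (LinearMap.lsmul R M x)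
  mono n := inf_le_inf (G.mono n) (Submodule.comap_mono (F.mono (n + 1)))
  smul_le n := by
    refine le_inf ((Submodule.smul_mono le_rfl inf_le_left).trans (G.smul_le n)) ?_
    rw [← Submodule.map_le_iff_le_comap, Submodule.map_smul'']
    exact (Submodule.smul_mono le_rfl (Submodule.map_le_iff_le_comap.2 inf_le_right)).trans
      (F.smul_le (n + 1))

/-- The filtration `F n + x G (n - 1)`: the quotient `G n` by it is the cokernel of multiplication
by `x` on the associated graded module of `G / F`. In degree `0` the truncated subtraction gives
`F 0 + x G 0`. -/
def sumFiltration (F G : I.Filtration M) (x : R) : I.Filtration M where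
  N n := F.N n ⊔ (G.N (n - 1)).map (LinearMap.lsmul R M x)
  mono n := sup_le_sup (F.mono n) (Submodule.map_mono (G.antitone (by omega)))
  smul_le n := by
    rw [Submodule.smul_sup, ← Submodule.map_smul'']
    refine sup_le_sup (F.smul_le n) (Submodule.map_mono ?_)
    rcases n with _ | n
    · exact Submodule.smul_le_right
    · exact G.smul_le n

variable {F G : I.Filtration M} {x : R}

lemma map_lsmul_le (hx : x ∈ I) (n : ℕ) :
    (G.N n).map (LinearMap.lsmul R M x) ≤ G.N (n + 1) := by
  rintro _ ⟨v, hv, rfl⟩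
  exact G.smul_le n (Submodule.smul_mem_smul hx hv)

lemma le_kerFiltration (hx : x ∈ I) (hFG : F ≤ G) : F ≤ kerFiltration F G x := fun n =>
  le_inf (hFG n) (Submodule.map_le_iff_le_comap.1 (map_lsmul_le hx n))

lemma kerFiltration_le : kerFiltration F G x ≤ G := fun _ => inf_le_left

lemma le_sumFiltration : F ≤ sumFiltration F G x := fun _ => le_sup_left

lemma sumFiltration_le (hx : x ∈ I) (hFG : F ≤ G) : sumFiltration F G x ≤ G := by
  refine fun n => sup_le (hFG n) ?_
  rcases n with _ | n
  · rintro _ ⟨v, hv, rfl⟩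
    exact Submodule.smul_mem _ x hv
  · exact map_lsmul_le hx n

lemma relLength_succ_add_kerFiltration (hx : x ∈ I) (hFG : F ≤ G) (n : ℕ) :
    relLength (F.N (n + 1)) (G.N (n + 1)) + relLength (F.N n) ((kerFiltration F G x).N n) =
      relLength (F.N n) (G.N n) +
        relLength ((sumFiltration F G x).N (n + 1)) (G.N (n + 1)) := by
  have hsum : relLength (F.N (n + 1)) ((sumFiltration F G x).N (n + 1)) =
      relLength (F.N (n + 1)) ((G.N n).map (LinearMap.lsmul R M x)) := relLength_sup_left _ _
  have hadd : relLength (F.N (n + 1)) (G.N (n + 1)) = _ :=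
    relLength_add (le_sumFiltration (x := x) (n + 1)) (sumFiltration_le hx hFG (n + 1))
  have hker : relLength (F.N n) (G.N n) = relLength (F.N n) ((kerFiltration F G x).N n) + _ :=
    relLength_eq_add (Submodule.map_le_iff_le_comap.1 (map_lsmul_le hx n)) (G.N n)
  rw [hadd, hker, hsum]
  ring

/-- **Hilbert–Serre**, by induction on the number of generators of the ideal modulo `J`. -/
theorem isEventuallyPoly_relLength [IsNoetherianRing R] [Module.Finite R M] {S : Finset R}
    (hSI : ∀ x ∈ S, x ∈ I) {J : Ideal R} (hI : I ≤ Ideal.span S ⊔ J) {F G : I.Filtration M}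
    (hFG : F ≤ G) (hG : G.Stable) (hJ : ∀ n, J • G.N n ≤ F.N (n + 1))
    (hfin : ∀ n, relLength (F.N n) (G.N n) ≠ ⊤) :
    IsEventuallyPoly S.card fun n => (relLength (F.N n) (G.N n)).toNat := by
  classical
  induction S using Finset.induction_on generalizing J F G with
  | empty =>
    obtain ⟨n₀, h₀⟩ := hG
    refine .zero (eventually_atTop.2 ⟨n₀ + 1, fun n hn => ?_⟩)
    obtain ⟨n, rfl⟩ := Nat.exists_eq_add_of_lt hn
    have hle : G.N (n₀ + n + 1) ≤ F.N (n₀ + n + 1) := by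
      rw [← h₀ _ (Nat.le_add_right n₀ n)]
      exact (Submodule.smul_mono_left (by simpa using hI)).trans (hJ _)
    rw [relLength_eq_zero_of_le hle, ENat.toNat_zero, Nat.cast_zero]
  | insert x S hxS ih =>
    have hx : x ∈ I := hSI x (Finset.mem_insert_self x S)
    have hSI' : ∀ y ∈ S, y ∈ I := fun y hy => hSI y (Finset.mem_insert_of_mem hy)
    have hI' : I ≤ Ideal.span S ⊔ (Ideal.span {x} ⊔ J) := by
      rwa [Finset.coe_insert, Ideal.span_insert, sup_comm (Ideal.span {x}), sup_assoc] at hI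
    have hKfin (n : ℕ) : relLength (F.N n) ((kerFiltration F G x).N n) ≠ ⊤ :=
      ne_top_of_le_ne_top (hfin n) (relLength_mono_right _ (kerFiltration_le n))
    have hDfin (n : ℕ) : relLength ((sumFiltration F G x).N n) (G.N n) ≠ ⊤ :=
      ne_top_of_le_ne_top (hfin n) (relLength_anti_left (le_sumFiltration n) _)
    have hK := ih hSI' hI' (le_kerFiltration hx hFG) (hG.of_le kerFiltration_le)
      (fun n => by
        rw [Submodule.sup_smul, Submodule.ideal_span_singleton_smul]
        exact sup_le (Submodule.map_le_iff_le_comap.2 inf_le_right)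
          ((Submodule.smul_mono le_rfl (kerFiltration_le n)).trans (hJ n))) hKfin
    have hD := ih hSI' hI' (sumFiltration_le hx hFG) hG
      (fun n => by
        rw [Submodule.sup_smul, Submodule.ideal_span_singleton_smul]
        exact sup_le le_sup_right ((hJ n).trans (le_sumFiltration _))) hDfin
    rw [Finset.card_insert_of_notMem hxS]
    refine .of_succ_sub ?_
    convert (hD.comp_add 1).sub hK using 2 with n
    have h := congrArg ENat.toNat (relLength_succ_add_kerFiltration hx hFG n)
    rw [ENat.toNat_add (hfin _) (hKfin n), ENat.toNat_add (hfin n) (hDfin _)] at h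
    rw [sub_eq_sub_iff_add_eq_add]
    exact_mod_cast h.trans (add_comm _ _)

end HilbertSerre

section FiniteLength

lemma isFiniteLength_of_isArtinianRing_quotient_annihilator {R X : Type*} [CommRing R]
    [AddCommGroup X] [Module R X] [Module.Finite R X]
    [IsArtinianRing (R ⧸ Module.annihilator R X)] :
    IsFiniteLength R X := by
  let := Module.quotientAnnihilator (R := R) (M := X)
  have : IsScalarTower R (R ⧸ Module.annihilator R X) X :=
    (Module.isTorsionBySet_annihilator R X).isScalarTower
  have : Module.Finite (R ⧸ Module.annihilator R X) X := .of_restrictScalars_finite R _ _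
  let e : X →ₛₗ[Ideal.Quotient.mk (Module.annihilator R X)] X :=
    { toFun := id, map_add' := fun _ _ => rfl, map_smul' := fun _ _ => rfl }
  exact isFiniteLength_iff_isNoetherian_isArtinian.2
    ⟨(LinearMap.isNoetherian_iff_of_bijective e Function.bijective_id).2 inferInstance,
      (LinearMap.isArtinian_iff_of_bijective e Function.bijective_id).2 inferInstance⟩

open IsLocalRing

variable {A : Type*} [CommRing A] [IsLocalRing A] [IsNoetherianRing A]
  {X : Type*} [AddCommGroup X] [Module A X] [Module.Finite A X]

lemma isFiniteLength_of_pow_le_annihilator {k : ℕ}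
    (h : maximalIdeal A ^ k ≤ Module.annihilator A X) : IsFiniteLength A X := by
  rcases eq_or_ne (Module.annihilator A X) ⊤ with htop | htop
  · have : Subsingleton X := Module.annihilator_eq_top_iff.1 htop
    exact .of_subsingleton
  have hmin : maximalIdeal A ∈ (Module.annihilator A X).minimalPrimes :=
    ⟨⟨inferInstance, le_maximalIdeal htop⟩, fun p hp _ => hp.1.le_of_pow_le (h.trans hp.2)⟩
  have := quotient_artinian_of_mem_minimalPrimes_of_isLocalRing _ hmin
  exact isFiniteLength_of_isArtinianRing_quotient_annihilator

lemma relLength_ne_top {k : ℕ} {p q : Submodule A X} (h : maximalIdeal A ^ k • q ≤ p) :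
    relLength p q ≠ ⊤ := by
  rw [relLength, Module.length_ne_top_iff]
  refine isFiniteLength_of_pow_le_annihilator (k := k) (Submodule.le_annihilator_iff.2 ?_)
  rw [← Submodule.map_smul'', ← LinearMap.le_ker_iff_map, Submodule.ker_mkQ]
  exact h

end FiniteLength

section HilbertSamuel

open IsLocalRing

lemma exists_pow_smul_inf_le {R V : Type*} [CommRing R] [IsNoetherianRing R] [AddCommGroup V]
    [Module R V] [Module.Finite R V] (I : Ideal R) (L : Submodule R V) :
    ∃ k : ℕ, ∀ n, I ^ n • ⊤ ⊓ L ≤ I ^ (n - k) • L := by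
  obtain ⟨k, hk⟩ := I.exists_pow_inf_eq_pow_smul L
  refine ⟨k, fun n => ?_⟩
  rcases le_or_gt k n with hkn | hkn
  · rw [hk n hkn]
    exact Submodule.smul_mono le_rfl inf_le_right
  · rw [Nat.sub_eq_zero_of_le hkn.le, pow_zero, Ideal.one_eq_top, Submodule.top_smul]
    exact inf_le_right

lemma pow_smul_inf_le {R V : Type*} [CommRing R] [AddCommGroup V] [Module R V] {I : Ideal R}
    {L : Submodule R V} {k : ℕ} (hk : ∀ n, I ^ n • ⊤ ⊓ L ≤ I ^ (n - k) • L) (n : ℕ) :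
    I ^ k • (I ^ n • ⊤ ⊓ L) ≤ I ^ n • L := by
  refine (le_inf ?_ (Submodule.smul_le_right.trans inf_le_right)).trans
    ((hk (n + k)).trans_eq (by rw [Nat.add_sub_cancel]))
  rw [add_comm, pow_add, mul_smul]
  exact Submodule.smul_mono le_rfl inf_le_left

lemma coe_dim (R : Type*) [CommRing R] [FiniteRingKrullDim R] :
    (dim R : WithBot ℕ∞) = ringKrullDim R := by
  obtain ⟨a, ha⟩ := WithBot.ne_bot_iff_exists.1 (ringKrullDim_ne_bot (R := R))
  lift a to ℕ using fun h => ringKrullDim_ne_top (R := R) (by rw [← ha, h]; rfl)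
  rw [dim, ← ha]
  rfl

variable {A : Type*} [CommRing A] [IsLocalRing A] [IsNoetherianRing A]

lemma exists_span_isParameterIdeal : ∃ (S : Finset A) (k : ℕ), S.card = dim A ∧
    Ideal.span (S : Set A) ≤ maximalIdeal A ∧ maximalIdeal A ^ k ≤ Ideal.span S := by
  obtain ⟨S, hS, hcard⟩ := (maximalIdeal A).exists_finset_card_eq_height_of_isNoetherianRing
  have hrad : maximalIdeal A ≤ (Ideal.span (S : Set A)).radical := by
    rw [Ideal.radical_eq_sInf]
    exact le_sInf fun p ⟨hp, hprime⟩ => hS.2 ⟨hprime, hp⟩ (le_maximalIdeal hprime.ne_top)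
  obtain ⟨k, hk⟩ := Ideal.exists_pow_le_of_le_radical_of_fg hrad (IsNoetherian.noetherian _)
  refine ⟨S, k, ?_, hS.1.2, hk⟩
  rw [← Nat.cast_inj (R := WithBot ℕ∞), coe_dim, ← maximalIdeal_height_eq_ringKrullDim, ← hcard]
  rfl

variable {V : Type*} [AddCommGroup V] [Module A V] [Module.Finite A V]

lemma relLength_pow_smul_ne_top {I : Ideal A} {k : ℕ} (hk : maximalIdeal A ^ k ≤ I)
    (L : Submodule A V) (n : ℕ) : relLength (I ^ n • L) L ≠ ⊤ :=
  relLength_ne_top (k := k * n) <| by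
    rw [pow_mul]
    exact Submodule.smul_mono_left (Ideal.pow_right_mono hk n)

theorem isEventuallyPoly_hilbertSamuel {I : Ideal A} {S : Finset A} (hI : Ideal.span S = I) {k : ℕ}
    (hk : maximalIdeal A ^ k ≤ I) (L : Submodule A V) :
    IsEventuallyPoly (S.card + 1) fun n => (relLength (I ^ n • L) L).toNat := by
  have hsucc (n : ℕ) : I ^ n • I • L = I ^ (n + 1) • L := by rw [← mul_smul, pow_succ]
  have hle (n : ℕ) : I ^ (n + 1) • L ≤ I ^ n • L :=
    Submodule.smul_mono_left (Ideal.pow_le_pow_right n.le_succ)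
  have hfin (n : ℕ) : relLength (I ^ (n + 1) • L) (I ^ n • L) ≠ ⊤ :=
    relLength_ne_top (k := k) <| by
      rw [pow_succ', mul_smul]
      exact Submodule.smul_mono_left hk
  have hgr := isEventuallyPoly_relLength (M := V) (I := I) (J := ⊥) (S := S)
    (F := I.stableFiltration (I • L)) (G := I.stableFiltration L)
    (fun x hx => hI ▸ Ideal.subset_span hx) (by simp [hI]) (fun n => (hsucc n).trans_le (hle n))
    (I.stableFiltration_stable L) (by simp)
    (fun n => (congrArg (relLength · _) (hsucc n)).trans_ne (hfin n))
  refine .of_succ_sub ?_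
  convert hgr using 2 with n
  rw [relLength_add (hle n) Submodule.smul_le_right,
    ENat.toNat_add (hfin n) (relLength_pow_smul_ne_top hk L n), Nat.cast_add, add_sub_cancel_right,
    ← hsucc n]
  rfl

lemma isEventuallyPoly_relLength_pow_smul (L : Submodule A V) :
    IsEventuallyPoly (dim A + 1) fun n => (relLength (maximalIdeal A ^ n • L) L).toNat := by
  obtain ⟨T, hT⟩ := (IsNoetherian.noetherian (maximalIdeal A) : (maximalIdeal A).FG)
  obtain ⟨S, k, hS, hSm, hk⟩ := exists_span_isParameterIdeal (A := A)
  rw [← hS]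
  refine (isEventuallyPoly_hilbertSamuel (k := 1) hT (by simp) L).of_le
    (isEventuallyPoly_hilbertSamuel rfl hk L)
    (.of_forall fun n => Nat.cast_nonneg _) (.of_forall fun n => Nat.cast_le.2 ?_)
  exact ENat.toNat_le_toNat
    (relLength_anti_left (Submodule.smul_mono_left (Ideal.pow_right_mono hSm n)) L)
    (relLength_pow_smul_ne_top hk L n)

lemma exists_isEventuallyPoly_relLength_inf (L : Submodule A V) :
    ∃ r, IsEventuallyPoly r fun n =>
      (relLength (maximalIdeal A ^ n • L) (maximalIdeal A ^ n • ⊤ ⊓ L)).toNat := by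
  set m := maximalIdeal A
  obtain ⟨T, hT⟩ := (IsNoetherian.noetherian m : m.FG)
  obtain ⟨k, hk⟩ := exists_pow_smul_inf_le m L
  exact ⟨T.card, isEventuallyPoly_relLength (I := m) (J := ⊥)
    (F := m.stableFiltration L) (G := m.stableFiltration ⊤ ⊓ m.trivialFiltration L)
    (fun x hx => hT ▸ Ideal.subset_span hx) (by simp [hT])
    (fun n => le_inf (Submodule.smul_mono le_rfl le_top) Submodule.smul_le_right)
    ((m.stableFiltration_stable ⊤).inter_right _) (by simp)
    (fun n => relLength_ne_top (pow_smul_inf_le hk n))⟩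

/-- The degree drops because, by Artin–Rees, the length is at most the difference of the
Hilbert–Samuel function of `L` over a bounded step. -/
theorem isEventuallyPoly_relLength_inf (L : Submodule A V) :
    IsEventuallyPoly (dim A) fun n =>
      (relLength (maximalIdeal A ^ n • L) (maximalIdeal A ^ n • ⊤ ⊓ L)).toNat := by
  set m := maximalIdeal A
  obtain ⟨r, hr⟩ := exists_isEventuallyPoly_relLength_inf L
  obtain ⟨k, hk⟩ := exists_pow_smul_inf_le m L
  refine hr.of_le ((isEventuallyPoly_relLength_pow_smul L).sub_comp_sub k)
    (.of_forall fun n => Nat.cast_nonneg _) (.of_forall fun n => ?_)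
  have hfin (n : ℕ) : relLength (m ^ n • L) L ≠ ⊤ :=
    relLength_pow_smul_ne_top (k := 1) (by simp [m]) L n
  have hadd : relLength (m ^ n • L) L =
      relLength (m ^ n • L) (m ^ (n - k) • L) + relLength (m ^ (n - k) • L) L :=
    relLength_add (Submodule.smul_mono_left (Ideal.pow_le_pow_right (Nat.sub_le n k)))
      Submodule.smul_le_right
  have hfin' : relLength (m ^ n • L) (m ^ (n - k) • L) ≠ ⊤ :=
    ne_top_of_le_ne_top (hfin n) (hadd ▸ le_self_add)
  rw [hadd, ENat.toNat_add hfin' (hfin _), Nat.cast_add, add_sub_cancel_right, Nat.cast_le]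
  exact ENat.toNat_le_toNat (relLength_mono_right _ (hk n)) hfin'

end HilbertSamuel

/-! ### Tensoring short exact sequences -/

section Connecting

variable {A : Type*} [CommRing A]
  {N E M : Type*} [AddCommGroup N] [Module A N] [AddCommGroup E] [Module A E]
  [AddCommGroup M] [Module A M]
  {Z P Q : Type*} [AddCommGroup Z] [Module A Z] [AddCommGroup P] [Module A P]
  [AddCommGroup Q] [Module A Q]
  {f : N →ₗ[A] E} {g : E →ₗ[A] M} {j : Z →ₗ[A] P} {p : P →ₗ[A] Q}

lemma rTensor_lTensor_comm (f : N →ₗ[A] E) (j : Z →ₗ[A] P) (y : N ⊗[A] Z) :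
    f.rTensor P (j.lTensor N y) = j.lTensor E (f.rTensor Z y) := by
  rw [← LinearMap.comp_apply, LinearMap.rTensor_comp_lTensor, ← LinearMap.lTensor_comp_rTensor,
    LinearMap.comp_apply]

lemma map_ker_lTensor_le (f : N →ₗ[A] E) (j : Z →ₗ[A] P) :
    (LinearMap.ker (j.lTensor N)).map (f.rTensor Z) ≤ LinearMap.ker (j.lTensor E) := by
  rintro _ ⟨y, hy, rfl⟩
  rw [LinearMap.mem_ker, ← rTensor_lTensor_comm, LinearMap.mem_ker.1 hy, map_zero]

lemma mem_ker_lTensor_iff [Module.Flat A P] (hf : Function.Injective f) {y : N ⊗[A] Z} :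
    y ∈ LinearMap.ker (j.lTensor N) ↔ f.rTensor Z y ∈ LinearMap.ker (j.lTensor E) := by
  rw [LinearMap.mem_ker, LinearMap.mem_ker, ← rTensor_lTensor_comm,
    map_eq_zero_iff _ (Module.Flat.rTensor_preserves_injective_linearMap f hf)]

lemma ker_rTensor_le_ker_lTensor [Module.Flat A P] (hf : Function.Injective f) :
    LinearMap.ker (f.rTensor Z) ≤ LinearMap.ker (j.lTensor N) := fun _ hy =>
  (mem_ker_lTensor_iff hf).2 (LinearMap.mem_ker.1 hy ▸ zero_mem _)

lemma map_ker_lTensor_eq_inf [Module.Flat A P] (hf : Function.Injective f)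
    (hfg : Function.Exact f g) (hg : Function.Surjective g) :
    (LinearMap.ker (j.lTensor N)).map (f.rTensor Z) =
      LinearMap.ker (j.lTensor E) ⊓ LinearMap.ker (g.rTensor Z) := by
  rw [LinearMap.exact_iff.1 (rTensor_exact Z hfg hg), inf_comm, ← Submodule.map_comap_eq]
  congr 1
  ext y
  exact mem_ker_lTensor_iff hf

/-- The connecting homomorphism comes from the snake lemma applied to tensoring
`N → E → M` with `j : Z → P`. -/
lemma exists_connecting [Module.Flat A P] (hf : Function.Injective f) (hfg : Function.Exact f g)
    (hg : Function.Surjective g) (hjp : Function.Exact j p) (hp : Function.Surjective p) :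
    ∃ δ : LinearMap.ker (j.lTensor M) →ₗ[A] N ⊗[A] Q,
      LinearMap.ker δ =
        ((LinearMap.ker (j.lTensor E)).map (g.rTensor Z)).submoduleOf
          (LinearMap.ker (j.lTensor M)) ∧
      LinearMap.range δ = LinearMap.ker (f.rTensor Q) := by
  have hs := LinearMap.rTensor_surjective Z hg
  have hi := Module.Flat.rTensor_preserves_injective_linearMap (M := P) f hf
  let δ := SnakeLemma.δ (j.lTensor N) (j.lTensor E) (j.lTensor M) (f.rTensor Z) (g.rTensor Z)
    (rTensor_exact Z hfg hg) (f.rTensor P) (g.rTensor P) (rTensor_exact P hfg hg)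
    (LinearMap.ext (rTensor_lTensor_comm f j)) (LinearMap.ext (rTensor_lTensor_comm g j))
    (Function.surjInv hs) (funext (Function.surjInv_eq hs))
    (Function.invFun (f.rTensor P)) (funext (Function.leftInverse_invFun hi))
    (LinearMap.ker (j.lTensor M)).subtype (LinearMap.exact_subtype_ker_map _)
    (p.lTensor N) (lTensor_exact N hjp hp)
  have hker : Function.Exact ((g.rTensor Z).restrict (Submodule.map_le_iff_le_comap.1
      (map_ker_lTensor_le g j))) δ :=
    SnakeLemma.exact_δ_right _ _ _ _ _ _ _ _ _ _ _ _ _ _ _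
      (LinearMap.ker (j.lTensor E)).subtype (LinearMap.exact_subtype_ker_map _) _ _ _ _
      _ rfl (Submodule.subtype_injective _)
  have hrange : Function.Exact δ (f.rTensor Q) :=
    SnakeLemma.exact_δ_left _ _ _ _ _ _ _ _ _ _ _ _ _ _ _ _ _ _ _
      (p.lTensor E) (lTensor_exact E hjp hp) (f.rTensor Q)
      (LinearMap.ext fun y => (rTensor_lTensor_comm f p y)) (LinearMap.lTensor_surjective N hp)
  refine ⟨δ, ?_, (LinearMap.exact_iff.1 hrange).symm⟩
  rw [LinearMap.exact_iff.1 hker]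
  ext x
  simp [Submodule.submoduleOf]

lemma nonempty_ker_lTensor_equiv_ker_rTensor [Module.Flat A P] [Module.Flat A E]
    (hf : Function.Injective f) (hfg : Function.Exact f g) (hg : Function.Surjective g)
    (hj : Function.Injective j) (hjp : Function.Exact j p) (hp : Function.Surjective p) :
    Nonempty (LinearMap.ker (j.lTensor M) ≃ₗ[A] LinearMap.ker (f.rTensor Q)) := by
  obtain ⟨δ, hker, hrange⟩ := exists_connecting hf hfg hg hjp hp
  have hE : LinearMap.ker (j.lTensor E) = ⊥ :=
    LinearMap.ker_eq_bot.2 (Module.Flat.lTensor_preserves_injective_linearMap j hj)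
  rw [hE, Submodule.map_bot, Submodule.submoduleOf, Submodule.comap_bot, Submodule.ker_subtype,
    LinearMap.ker_eq_bot] at hker
  exact ⟨(LinearEquiv.ofInjective δ hker).trans (LinearEquiv.ofEq _ _ hrange)⟩

theorem length_ker_lTensor_add [Module.Flat A P] (hf : Function.Injective f)
    (hfg : Function.Exact f g) (hg : Function.Surjective g) (hjp : Function.Exact j p)
    (hp : Function.Surjective p) :
    Module.length A (LinearMap.ker (j.lTensor M)) + Module.length A (LinearMap.ker (j.lTensor N)) =
      Module.length A (LinearMap.ker (j.lTensor E)) +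
        (Module.length A (LinearMap.ker (f.rTensor Z)) +
          Module.length A (LinearMap.ker (f.rTensor Q))) := by
  obtain ⟨δ, hker, hrange⟩ := exists_connecting hf hfg hg hjp hp
  have hM : Module.length A (LinearMap.ker (j.lTensor M)) =
      Module.length A ((LinearMap.ker (j.lTensor E)).map (g.rTensor Z)) +
        Module.length A (LinearMap.ker (f.rTensor Q)) := by
    rw [length_eq_length_ker_add_length_range δ, hrange, hker,
      (Submodule.submoduleOfEquivOfLe (map_ker_lTensor_le g j)).length_eq]
  have hN := length_eq_length_inf_ker_add_length_map (f.rTensor Z) (LinearMap.ker (j.lTensor N))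
  rw [inf_eq_right.2 (ker_rTensor_le_ker_lTensor hf), map_ker_lTensor_eq_inf hf hfg hg] at hN
  rw [hM, hN,
    length_eq_length_inf_ker_add_length_map (g.rTensor Z) (LinearMap.ker (j.lTensor E))]
  ring

end Connecting

section TorOne

variable {A : Type*} [CommRing A] (I : Ideal A)
  {V : Type*} [AddCommGroup V] [Module A V] {M : Type*} [AddCommGroup M] [Module A M]

/-- `Tor₁(X, A/I)`, realised as the kernel of `X ⊗ I → X ⊗ A`. -/
abbrev torOne (X : Type*) [AddCommGroup X] [Module A X] : Submodule A (X ⊗[A] I) :=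
  LinearMap.ker (I.subtype.lTensor X)

/-- The multiplication map `X ⊗ I → X`, `x ⊗ a ↦ a x`. -/
def smulMap (X : Type*) [AddCommGroup X] [Module A X] : X ⊗[A] I →ₗ[A] X :=
  (TensorProduct.rid A X).toLinearMap ∘ₗ I.subtype.lTensor X

lemma ker_smulMap : LinearMap.ker (smulMap I M) = torOne I M :=
  LinearEquiv.ker_comp _ _

lemma comp_smulMap (π : V →ₗ[A] M) : π ∘ₗ smulMap I V = smulMap I M ∘ₗ π.rTensor I := by
  ext v a
  simp [smulMap]

lemma range_smulMap : LinearMap.range (smulMap I M) = I • ⊤ := by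
  refine le_antisymm ?_ (Submodule.smul_le.2 fun a ha x _ => ⟨x ⊗ₜ ⟨a, ha⟩, by simp [smulMap]⟩)
  rintro _ ⟨y, rfl⟩
  induction y with
  | zero => simp
  | tmul x a => simpa [smulMap] using Submodule.smul_mem_smul a.2 Submodule.mem_top
  | add y z hy hz => simpa using add_mem hy hz

lemma map_comap_smulMap (L : Submodule A M) :
    (L.comap (smulMap I M)).map (smulMap I M) = I • ⊤ ⊓ L := by
  rw [Submodule.map_comap_eq, range_smulMap]

variable {I} {π : V →ₗ[A] M}

lemma torOne_eq_map (hπ : Function.Surjective π) :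
    torOne I M = ((LinearMap.ker π).comap (smulMap I V)).map (π.rTensor I) := by
  rw [← LinearMap.ker_comp, comp_smulMap, LinearMap.ker_comp, ker_smulMap,
    Submodule.map_comap_eq_of_surjective (LinearMap.rTensor_surjective _ hπ)]

lemma ker_rTensor_eq_comap [Module.Flat A V] (hπ : Function.Surjective π) :
    LinearMap.ker (π.rTensor I) = (I • LinearMap.ker π).comap (smulMap I V) := by
  have hinj : Function.Injective (smulMap I V) := by
    rw [← LinearMap.ker_eq_bot, ker_smulMap, LinearMap.ker_eq_bot]
    exact Module.Flat.lTensor_preserves_injective_linearMap _ (Submodule.subtype_injective I)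
  have hrange : (LinearMap.range ((LinearMap.ker π).subtype.rTensor I)).map (smulMap I V) =
      I • LinearMap.ker π := by
    rw [← LinearMap.range_comp, ← comp_smulMap, LinearMap.range_comp, range_smulMap,
      Submodule.map_smul'', Submodule.map_subtype_top]
  rw [← hrange, Submodule.comap_map_eq_of_injective hinj,
    LinearMap.exact_iff.1 (rTensor_exact I (LinearMap.exact_subtype_ker_map π) hπ)]

theorem length_torOne [Module.Flat A V] (hπ : Function.Surjective π) :
    Module.length A (torOne I M) =
      relLength (I • LinearMap.ker π) (I • ⊤ ⊓ LinearMap.ker π) := by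
  rw [← relLength_bot, torOne_eq_map hπ, ← relLength_comap, Submodule.comap_bot,
    ker_rTensor_eq_comap hπ, relLength_comap, map_comap_smulMap]

lemma exists_pow_le_annihilator_torOne [IsNoetherianRing A] (I : Ideal A) (M : Type*)
    [AddCommGroup M] [Module A M] [Module.Finite A M] :
    ∃ k : ℕ, ∀ n, I ^ k ≤ Module.annihilator A (torOne (I ^ n) M) := by
  obtain ⟨m, π, hπ⟩ := Module.Finite.exists_fin' A M
  obtain ⟨k, hk⟩ := exists_pow_smul_inf_le I (LinearMap.ker π)
  refine ⟨k, fun n => ?_⟩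
  rw [Submodule.le_annihilator_iff, torOne_eq_map hπ, ← Submodule.map_smul'',
    ← LinearMap.le_ker_iff_map, ker_rTensor_eq_comap hπ, ← Submodule.map_le_iff_le_comap,
    Submodule.map_smul'', map_comap_smulMap]
  exact pow_smul_inf_le hk n

open IsLocalRing

variable {A : Type*} [CommRing A] [IsLocalRing A] [IsNoetherianRing A]

lemma isFiniteLength_torOne {M : Type*} [AddCommGroup M] [Module A M] [Module.Finite A M] (n : ℕ) :
    IsFiniteLength A (torOne (maximalIdeal A ^ n) M) := by
  obtain ⟨k, hk⟩ := exists_pow_le_annihilator_torOne (maximalIdeal A) M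
  exact isFiniteLength_of_pow_le_annihilator (hk n)

theorem isEventuallyPoly_length_torOne (M : Type*) [AddCommGroup M] [Module A M]
    [Module.Finite A M] :
    IsEventuallyPoly (dim A) fun n => (Module.length A (torOne (maximalIdeal A ^ n) M)).toNat := by
  obtain ⟨m, π, hπ⟩ := Module.Finite.exists_fin' A M
  simp only [length_torOne hπ]
  exact isEventuallyPoly_relLength_inf _

end TorOne

section Tor

lemma exact_rangeRestrict {A P₂ P₁ P₀ : Type*} [CommRing A] [AddCommGroup P₂] [Module A P₂]
    [AddCommGroup P₁] [Module A P₁] [AddCommGroup P₀] [Module A P₀] {d₂ : P₂ →ₗ[A] P₁}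
    {d₁ : P₁ →ₗ[A] P₀} (h : Function.Exact d₂ d₁) : Function.Exact d₂ d₁.rangeRestrict := by
  rw [LinearMap.exact_iff, LinearMap.ker_rangeRestrict]
  exact LinearMap.exact_iff.1 h

variable {A : Type u} [CommRing A]

lemma nonempty_homology_equiv (S : ShortComplex (ModuleCat.{u} A)) {C : Type u} [AddCommGroup C]
    [Module A C] (c : S.X₂ →ₗ[A] C) (j : C →ₗ[A] S.X₃) (hc : Function.Surjective c)
    (hex : Function.Exact S.f.hom c) (hj : j ∘ₗ c = S.g.hom) :
    Nonempty (S.homology ≃ₗ[A] LinearMap.ker j) := by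
  have hjc : ∀ x, j (c x) = S.g.hom x := fun x => LinearMap.congr_fun hj x
  let φ : LinearMap.ker S.g.hom →ₗ[A] LinearMap.ker j :=
    c.restrict fun x hx => by rw [LinearMap.mem_ker, hjc]; exact hx
  have hφ : Function.Surjective φ := by
    rintro ⟨y, hy⟩
    obtain ⟨x, rfl⟩ := hc y
    exact ⟨⟨x, by rw [LinearMap.mem_ker, ← hjc]; exact hy⟩, rfl⟩
  have hk : LinearMap.range S.moduleCatToCycles = LinearMap.ker φ := by
    ext x
    rw [LinearMap.mem_ker, ← Subtype.coe_inj]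
    refine Iff.trans ?_ (hex x.1).symm
    exact ⟨fun ⟨y, hy⟩ => ⟨y, congrArg Subtype.val hy⟩, fun ⟨y, hy⟩ => ⟨y, Subtype.ext hy⟩⟩
  exact ⟨S.moduleCatHomologyIso.toLinearEquiv.trans
    ((Submodule.quotEquivOfEq _ _ hk).trans (φ.quotKerEquivOfSurjective hφ))⟩

/-- The first syzygy of `Y` in a projective resolution computes `Tor₁(M, Y)`. -/
lemma nonempty_tor_equiv_ker_lTensor (M : ModuleCat.{u} A) {Y : ModuleCat.{u} A}
    (R : ProjectiveResolution Y) :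
    Nonempty (((Tor (ModuleCat.{u} A) 1).obj M).obj Y ≃ₗ[A]
      LinearMap.ker ((LinearMap.range (R.complex.d 1 0).hom).subtype.lTensor M)) := by
  let T := (MonoidalCategory.tensoringLeft (ModuleCat.{u} A)).obj M
  let K := (T.mapHomologicalComplex _).obj R.complex
  let e : ((Tor (ModuleCat.{u} A) 1).obj M).obj Y ≅ (K.sc' 2 1 0).homology :=
    R.isoLeftDerivedObj T 1 ≪≫ K.homologyIsoSc' 2 1 0 (by simp) (by simp)
  let d₁ := (R.complex.d 1 0).hom
  have hex := exact_rangeRestrict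
    ((ShortComplex.ShortExact.moduleCat_exact_iff_function_exact _).1 (R.exact_succ 0))
  have hsurj := d₁.surjective_rangeRestrict
  have hcomp : (LinearMap.range d₁).subtype.lTensor M ∘ₗ d₁.rangeRestrict.lTensor M =
      d₁.lTensor M := by
    rw [← LinearMap.lTensor_comp]
    rfl
  obtain ⟨e'⟩ := nonempty_homology_equiv (K.sc' 2 1 0) (d₁.rangeRestrict.lTensor M)
    ((LinearMap.range d₁).subtype.lTensor M) (LinearMap.lTensor_surjective _ hsurj)
    (lTensor_exact M hex hsurj) hcomp
  exact ⟨e.toLinearEquiv.trans e'⟩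

lemma exists_exact_range_subtype {Y : ModuleCat.{u} A} (R : ProjectiveResolution Y) :
    ∃ p : R.complex.X 0 →ₗ[A] Y, Function.Surjective p ∧
      Function.Exact (LinearMap.range (R.complex.d 1 0).hom).subtype p := by
  let i := (HomologicalComplex.singleObjXSelf (ComplexShape.down ℕ) 0 Y).toLinearEquiv
  refine ⟨i.toLinearMap ∘ₗ (R.π.f 0).hom,
    i.surjective.comp ((ModuleCat.epi_iff_surjective _).1 inferInstance), ?_⟩
  have h := (ShortComplex.ShortExact.moduleCat_exact_iff_function_exact _).1 R.exact₀
  rw [LinearMap.exact_iff, LinearEquiv.ker_comp, Submodule.range_subtype]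
  exact LinearMap.exact_iff.1 h

theorem nonempty_tor_equiv_ker_rTensor {M Y : ModuleCat.{u} A} {L F : Type*} [AddCommGroup L]
    [Module A L] [AddCommGroup F] [Module A F] [Module.Flat A F] {ι : L →ₗ[A] F} {π : F →ₗ[A] M}
    (hι : Function.Injective ι) (hιπ : Function.Exact ι π) (hπ : Function.Surjective π) :
    Nonempty (((Tor (ModuleCat.{u} A) 1).obj M).obj Y ≃ₗ[A] LinearMap.ker (ι.rTensor Y)) := by
  let R := projectiveResolution Y
  have : Module.Projective A (R.complex.X 0) := (IsProjective.iff_projective _).2 (R.projective 0)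
  obtain ⟨p, hp, hjp⟩ := exists_exact_range_subtype R
  obtain ⟨e⟩ := nonempty_tor_equiv_ker_lTensor M R
  obtain ⟨e'⟩ := nonempty_ker_lTensor_equiv_ker_rTensor hι hιπ hπ
    (Submodule.subtype_injective _) hjp hp
  exact ⟨e.trans e'⟩

lemma nonempty_torOne_equiv_ker_rTensor {A L F M : Type*} [CommRing A] [AddCommGroup L] [Module A L]
    [AddCommGroup F] [Module A F] [AddCommGroup M] [Module A M] [Module.Flat A F] (I : Ideal A)
    {ι : L →ₗ[A] F} {π : F →ₗ[A] M}
    (hι : Function.Injective ι) (hιπ : Function.Exact ι π) (hπ : Function.Surjective π) :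
    Nonempty (torOne I M ≃ₗ[A] LinearMap.ker (ι.rTensor (A ⧸ I))) :=
  nonempty_ker_lTensor_equiv_ker_rTensor hι hιπ hπ (Submodule.subtype_injective I)
    (LinearMap.exact_subtype_mkQ I) (Submodule.mkQ_surjective I)

lemma nonempty_tor_equiv_torOne (M : ModuleCat.{u} A) (I : Ideal A) :
    Nonempty (((Tor (ModuleCat.{u} A) 1).obj M).obj (ModuleCat.of A (A ⧸ I)) ≃ₗ[A] torOne I M) := by
  have hπ := Finsupp.linearCombination_id_surjective A M
  have hι := Submodule.subtype_injective (LinearMap.ker (Finsupp.linearCombination A (id : M → M)))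
  obtain ⟨e⟩ := nonempty_tor_equiv_ker_rTensor (M := M) (Y := ModuleCat.of A (A ⧸ I)) hι
    (LinearMap.exact_subtype_ker_map _) hπ
  obtain ⟨e'⟩ := nonempty_torOne_equiv_ker_rTensor I hι (LinearMap.exact_subtype_ker_map _) hπ
  exact ⟨e.trans e'.symm⟩

open IsLocalRing in
lemma torLength_eq_length_torOne [IsLocalRing A] (M : ModuleCat.{u} A) (n : ℕ) :
    torLength A M n = (Module.length A (torOne (maximalIdeal A ^ (n + 1)) M)).toNat := by
  obtain ⟨e⟩ := nonempty_tor_equiv_torOne M (maximalIdeal A ^ (n + 1))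
  rw [torLength, e.length_eq]

end Tor

/-! ### Pushouts of a presentation -/

section Pushout

variable {A : Type*} [CommRing A]
  {L F M N E : Type*} [AddCommGroup L] [Module A L] [AddCommGroup F] [Module A F]
  [AddCommGroup M] [Module A M] [AddCommGroup N] [Module A N] [AddCommGroup E] [Module A E]
  {ι : L →ₗ[A] F} {π : F →ₗ[A] M} {f : N →ₗ[A] E} {g : E →ₗ[A] M}
  {φ : L →ₗ[A] N} {ψ : F →ₗ[A] E}

lemma coprod_surjective (hπ : Function.Surjective π) (hfg : Function.Exact f g)
    (hψ : g ∘ₗ ψ = π) : Function.Surjective (f.coprod ψ) := by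
  intro e
  obtain ⟨x, hx⟩ := hπ (g e)
  have hker : g (e - ψ x) = 0 := by rw [map_sub, ← LinearMap.comp_apply, hψ, hx, sub_self]
  obtain ⟨n, hn⟩ := (hfg _).1 hker
  exact ⟨(n, x), by simp [hn]⟩

lemma exact_prod_neg_coprod (hιπ : Function.Exact ι π) (hf : Function.Injective f)
    (hfg : Function.Exact f g) (hφ : f ∘ₗ φ = ψ ∘ₗ ι) (hψ : g ∘ₗ ψ = π) :
    Function.Exact (φ.prod (-ι)) (f.coprod ψ) := by
  have hφ' : ∀ l, f (φ l) = ψ (ι l) := LinearMap.congr_fun hφ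
  have hψ' : ∀ x, g (ψ x) = π x := LinearMap.congr_fun hψ
  rintro ⟨n, x⟩
  constructor
  · intro h
    replace h : f n + ψ x = 0 := h
    have hx : π x = 0 := by
      simpa only [map_add, hfg.apply_apply_eq_zero, zero_add, map_zero, hψ'] using congrArg g h
    obtain ⟨l, rfl⟩ := (hιπ x).1 hx
    have hn : f (φ (-l)) = f n := by
      rw [map_neg, map_neg, hφ', eq_neg_of_add_eq_zero_left h]
    exact ⟨-l, Prod.ext (hf hn) (by simp)⟩
  · rintro ⟨l, hl⟩
    rw [← hl, LinearMap.coprod_apply, LinearMap.prod_apply]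
    simp [hφ']

lemma map_ker_rTensor_le (Q : Type*) [AddCommGroup Q] [Module A Q] (hφ : f ∘ₗ φ = ψ ∘ₗ ι) :
    (LinearMap.ker (ι.rTensor Q)).map (φ.rTensor Q) ≤ LinearMap.ker (f.rTensor Q) := by
  rintro _ ⟨z, hz, rfl⟩
  rw [LinearMap.mem_ker, ← LinearMap.comp_apply, ← LinearMap.rTensor_comp, hφ,
    LinearMap.rTensor_comp, LinearMap.comp_apply, LinearMap.mem_ker.1 hz, map_zero]

theorem ker_rTensor_eq_map (Q : Type*) [AddCommGroup Q] [Module A Q] (hιπ : Function.Exact ι π)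
    (hπ : Function.Surjective π) (hf : Function.Injective f) (hfg : Function.Exact f g)
    (hφ : f ∘ₗ φ = ψ ∘ₗ ι) (hψ : g ∘ₗ ψ = π) :
    LinearMap.ker (f.rTensor Q) = (LinearMap.ker (ι.rTensor Q)).map (φ.rTensor Q) := by
  refine le_antisymm (fun y hy => ?_) (map_ker_rTensor_le Q hφ)
  have hy' : (f.coprod ψ).rTensor Q ((LinearMap.inl A N F).rTensor Q y) = 0 := by
    rw [← LinearMap.comp_apply, ← LinearMap.rTensor_comp, LinearMap.coprod_inl]
    exact hy
  obtain ⟨z, hz⟩ := (rTensor_exact Q (exact_prod_neg_coprod hιπ hf hfg hφ hψ)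
    (coprod_surjective hπ hfg hψ) _).1 hy'
  have hfst := congrArg ((LinearMap.fst A N F).rTensor Q) hz
  have hsnd := congrArg ((LinearMap.snd A N F).rTensor Q) hz
  simp only [← LinearMap.comp_apply, ← LinearMap.rTensor_comp, LinearMap.fst_prod,
    LinearMap.snd_prod, LinearMap.fst_comp_inl, LinearMap.snd_comp_inl, LinearMap.rTensor_id,
    LinearMap.rTensor_zero, LinearMap.rTensor_neg, LinearMap.id_apply, LinearMap.zero_apply,
    LinearMap.neg_apply, neg_eq_zero] at hfst hsnd
  exact ⟨z, hsnd, hfst⟩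

end Pushout

section Defect

variable {A : Type*} [CommRing A]
  {L F M N E : Type*} [AddCommGroup L] [Module A L] [AddCommGroup F] [Module A F]
  [AddCommGroup M] [Module A M] [AddCommGroup N] [Module A N] [AddCommGroup E] [Module A E]

lemma length_sup_le (p q : Submodule A N) :
    Module.length A (p ⊔ q : Submodule A N) ≤ Module.length A p + Module.length A q := by
  have hr : LinearMap.range (p.subtype.coprod q.subtype) = p ⊔ q := by
    rw [LinearMap.range_coprod, Submodule.range_subtype, Submodule.range_subtype]
  rw [← Module.length_prod, ← hr]
  exact Module.length_le_of_surjective _ (LinearMap.surjective_rangeRestrict _)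

/-- The length of the image under `φ ⊗ Q` of `ker (ι ⊗ Q)`. If `f` is the pushout of the injection
`ι` along `φ`, this is the length of `ker (f ⊗ Q)`. -/
def imgLength (Q : Type*) [AddCommGroup Q] [Module A Q] (ι : L →ₗ[A] F) (φ : L →ₗ[A] N) : ℕ∞ :=
  Module.length A ((LinearMap.ker (ι.rTensor Q)).map (φ.rTensor Q))

section ImgLength

variable {Q : Type*} [AddCommGroup Q] [Module A Q] {ι : L →ₗ[A] F}

lemma imgLength_zero : imgLength Q ι (0 : L →ₗ[A] N) = 0 := by
  rw [imgLength, LinearMap.rTensor_zero, Submodule.map_zero]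
  exact Module.length_bot

lemma imgLength_add_le (φ ψ : L →ₗ[A] N) :
    imgLength Q ι (φ + ψ) ≤ imgLength Q ι φ + imgLength Q ι ψ := by
  refine (length_le_of_le ?_).trans (length_sup_le _ _)
  rw [LinearMap.rTensor_add]
  exact Submodule.map_add_le _ _ _

lemma imgLength_smul_le (a : A) (φ : L →ₗ[A] N) : imgLength Q ι (a • φ) ≤ imgLength Q ι φ := by
  refine length_le_of_le ?_
  rw [LinearMap.rTensor_smul]
  rintro _ ⟨z, hz, rfl⟩
  exact ⟨a • z, Submodule.smul_mem _ _ hz, by simp⟩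

lemma imgLength_smul_eq_zero {a : A} (ha : a ∈ Module.annihilator A (LinearMap.ker (ι.rTensor Q)))
    (φ : L →ₗ[A] N) : imgLength Q ι (a • φ) = 0 := by
  rw [imgLength, LinearMap.rTensor_smul, Module.length_eq_zero_iff,
    Submodule.subsingleton_iff_eq_bot, eq_bot_iff]
  rintro _ ⟨z, hz, rfl⟩
  have haz : a • z = 0 := congrArg Subtype.val (Module.mem_annihilator.1 ha ⟨z, hz⟩)
  rw [LinearMap.smul_apply, ← map_smul, haz, map_zero]
  exact zero_mem _

lemma imgLength_ne_top (h : IsFiniteLength A (LinearMap.ker (ι.rTensor Q))) (φ : L →ₗ[A] N) :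
    imgLength Q ι φ ≠ ⊤ := by
  rw [imgLength, Module.length_ne_top_iff]
  exact h.of_surjective (f := (φ.rTensor Q).submoduleMap _) (LinearMap.submoduleMap_surjective _ _)

end ImgLength

/-- The failure of additivity of `ℓ(Tor₁(-, A/I))` on the extension obtained by pushing out
a flat presentation `0 → L → F → M → 0` along `φ : L → N`, see `length_torOne_add`. -/
def pushoutDefect (I : Ideal A) (ι : L →ₗ[A] F) (φ : L →ₗ[A] N) : ℕ∞ :=
  imgLength I ι φ + imgLength (A ⧸ I) ι φ

variable {I : Ideal A} {ι : L →ₗ[A] F} {π : F →ₗ[A] M}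

lemma pushoutDefect_zero : pushoutDefect I ι (0 : L →ₗ[A] N) = 0 := by
  rw [pushoutDefect, imgLength_zero, imgLength_zero, add_zero]

lemma pushoutDefect_add_le (φ ψ : L →ₗ[A] N) :
    pushoutDefect I ι (φ + ψ) ≤ pushoutDefect I ι φ + pushoutDefect I ι ψ :=
  (add_le_add (imgLength_add_le φ ψ) (imgLength_add_le φ ψ)).trans_eq (add_add_add_comm _ _ _ _)

lemma pushoutDefect_smul_le (a : A) (φ : L →ₗ[A] N) :
    pushoutDefect I ι (a • φ) ≤ pushoutDefect I ι φ :=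
  add_le_add (imgLength_smul_le a φ) (imgLength_smul_le a φ)

lemma pushoutDefect_smul_eq_zero [Module.Flat A F] (hι : Function.Injective ι)
    (hιπ : Function.Exact ι π) (hπ : Function.Surjective π) {a : A}
    (haL : a ∈ Module.annihilator A (torOne I L)) (haM : a ∈ Module.annihilator A (torOne I M))
    (φ : L →ₗ[A] N) : pushoutDefect I ι (a • φ) = 0 := by
  obtain ⟨e⟩ := nonempty_torOne_equiv_ker_rTensor I hι hιπ hπ
  have hle := ker_rTensor_le_ker_lTensor (j := I.subtype) hι
  have haI := (Submodule.inclusion hle).annihilator_le_of_injective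
    (Submodule.inclusion_injective hle) haL
  rw [e.annihilator_eq] at haM
  rw [pushoutDefect, imgLength_smul_eq_zero haI, imgLength_smul_eq_zero haM, add_zero]

lemma pushoutDefect_ne_top [Module.Flat A F] (hι : Function.Injective ι)
    (hιπ : Function.Exact ι π) (hπ : Function.Surjective π) (hL : IsFiniteLength A (torOne I L))
    (hM : IsFiniteLength A (torOne I M)) (φ : L →ₗ[A] N) : pushoutDefect I ι φ ≠ ⊤ := by
  obtain ⟨e⟩ := nonempty_torOne_equiv_ker_rTensor I hι hιπ hπ
  have hle := ker_rTensor_le_ker_lTensor (j := I.subtype) hι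
  exact WithTop.add_ne_top.2
    ⟨imgLength_ne_top (hL.of_injective (Submodule.inclusion_injective hle)) φ,
      imgLength_ne_top (hM.of_surjective e.surjective) φ⟩

theorem length_torOne_add {f : N →ₗ[A] E} {g : E →ₗ[A] M} {φ : L →ₗ[A] N} {ψ : F →ₗ[A] E}
    (hιπ : Function.Exact ι π) (hπ : Function.Surjective π)
    (hf : Function.Injective f) (hfg : Function.Exact f g) (hg : Function.Surjective g)
    (hφ : f ∘ₗ φ = ψ ∘ₗ ι) (hψ : g ∘ₗ ψ = π) :
    Module.length A (torOne I M) + Module.length A (torOne I N) =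
      Module.length A (torOne I E) + pushoutDefect I ι φ := by
  rw [torOne, torOne, length_ker_lTensor_add hf hfg hg (LinearMap.exact_subtype_mkQ I)
    (Submodule.mkQ_surjective I), ker_rTensor_eq_map I hιπ hπ hf hfg hφ hψ,
    ker_rTensor_eq_map (A ⧸ I) hιπ hπ hf hfg hφ hψ]
  rfl

end Defect

section Asymptotics

open IsLocalRing

variable {A : Type u} [CommRing A] [IsLocalRing A]

variable {F N : Type u} [AddCommGroup F] [Module A F] [AddCommGroup N] [Module A N]
  {L : Submodule A F}

/-- The defect of additivity of `torLength` on the pushout of `0 → L → F → F/L → 0` along `φ`. -/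
def defect (φ : L →ₗ[A] N) (n : ℕ) : ℕ :=
  (pushoutDefect (maximalIdeal A ^ (n + 1)) L.subtype φ).toNat

lemma defect_zero (n : ℕ) : defect (0 : L →ₗ[A] N) n = 0 := by
  rw [defect, pushoutDefect_zero, ENat.toNat_zero]

variable [IsNoetherianRing A]

variable (N) in
lemma exists_defect_smul_eq_zero [Module.Finite A F] [Module.Flat A F] (L : Submodule A F) :
    ∃ k : ℕ, ∀ a ∈ maximalIdeal A ^ k, ∀ (φ : L →ₗ[A] N) (n : ℕ), defect (a • φ) n = 0 := by
  obtain ⟨k₁, h₁⟩ := exists_pow_le_annihilator_torOne (maximalIdeal A) L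
  obtain ⟨k₂, h₂⟩ := exists_pow_le_annihilator_torOne (maximalIdeal A) (F ⧸ L)
  refine ⟨k₁ + k₂, fun a ha φ n => ?_⟩
  rw [defect, pushoutDefect_smul_eq_zero L.injective_subtype (LinearMap.exact_subtype_mkQ L)
    L.mkQ_surjective (h₁ _ (Ideal.pow_le_pow_right (by omega) ha))
    (h₂ _ (Ideal.pow_le_pow_right (by omega) ha)), ENat.toNat_zero]

variable [Module.Finite A F] [Module.Flat A F]

lemma coe_defect (φ : L →ₗ[A] N) (n : ℕ) :
    (defect φ n : ℕ∞) = pushoutDefect (maximalIdeal A ^ (n + 1)) L.subtype φ :=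
  ENat.natCast_toNat <| pushoutDefect_ne_top L.injective_subtype (LinearMap.exact_subtype_mkQ L)
    L.mkQ_surjective (isFiniteLength_torOne _) (isFiniteLength_torOne _) φ

lemma defect_add_le (φ ψ : L →ₗ[A] N) (n : ℕ) : defect (φ + ψ) n ≤ defect φ n + defect ψ n := by
  rw [← Nat.cast_le (α := ℕ∞), Nat.cast_add, coe_defect, coe_defect, coe_defect]
  exact pushoutDefect_add_le φ ψ

lemma defect_smul_le (a : A) (φ : L →ₗ[A] N) (n : ℕ) : defect (a • φ) n ≤ defect φ n := by
  rw [← Nat.cast_le (α := ℕ∞), coe_defect, coe_defect]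
  exact pushoutDefect_smul_le a φ

/-- The homomorphisms whose defect is `o(n ^ (d - 1))`, where `d = dim A`; their pushouts are
the `T`-split extensions. -/
def negligible (L : Submodule A F) (N : Type u) [AddCommGroup N] [Module A N] :
    Submodule A (L →ₗ[A] N) where
  carrier := {φ | Tendsto (fun n : ℕ => ((dim A - 1).factorial : ℝ) / (n : ℝ) ^ (dim A - 1) *
    (defect φ n : ℝ)) atTop (𝓝 0)}
  zero_mem' := by simp [defect_zero]
  add_mem' {φ ψ} hφ hψ := by
    refine squeeze_zero (fun n => by positivity) (fun n => ?_) (by simpa using hφ.add hψ)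
    rw [← mul_add]
    gcongr
    exact_mod_cast defect_add_le φ ψ n
  smul_mem' a φ hφ := by
    refine squeeze_zero (fun n => by positivity) (fun n => ?_) hφ
    gcongr
    exact defect_smul_le a φ n

lemma mem_negligible_of_defect_eq_zero {φ : L →ₗ[A] N} (h : ∀ n, defect φ n = 0) :
    φ ∈ negligible L N := by
  change Tendsto _ _ _
  simp [h]

theorem exists_hasET (hd : 1 ≤ dim A) (M : ModuleCat.{u} A) [Module.Finite A M] :
    ∃ e, HasET A M e := by
  obtain ⟨r, hr⟩ := Nat.exists_eq_add_of_le' hd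
  have hpoly := (isEventuallyPoly_length_torOne (A := A) M).comp_add 1
  simp only [← torLength_eq_length_torOne, hr] at hpoly
  obtain ⟨e, he⟩ := hpoly.exists_tendsto_div_pow
  refine ⟨_, (he.const_mul ((dim A - 1).factorial : ℝ)).congr fun n => ?_⟩
  rw [hr, Nat.add_sub_cancel, mul_div_assoc', div_mul_eq_mul_div]

section Extension

variable {M N E : ModuleCat.{u} A} [Module.Finite A M] [Module.Finite A N] [Module.Finite A E]
  {π : F →ₗ[A] M} {f : N →ₗ[A] E} {g : E →ₗ[A] M} {φ : LinearMap.ker π →ₗ[A] N} {ψ : F →ₗ[A] E}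

lemma torLength_add (hπ : Function.Surjective π) (hf : Function.Injective f)
    (hfg : Function.Exact f g) (hg : Function.Surjective g)
    (hφ : f ∘ₗ φ = ψ ∘ₗ (LinearMap.ker π).subtype) (hψ : g ∘ₗ ψ = π) (n : ℕ) :
    torLength A M n + torLength A N n = torLength A E n + defect φ n := by
  have hcoe (X : ModuleCat.{u} A) [Module.Finite A X] :
      (torLength A X n : ℕ∞) = Module.length A (torOne (maximalIdeal A ^ (n + 1)) X) := by
    rw [torLength_eq_length_torOne]
    exact ENat.natCast_toNat (Module.length_ne_top_iff.2 (isFiniteLength_torOne _))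
  rw [← Nat.cast_inj (R := ℕ∞), Nat.cast_add, Nat.cast_add, hcoe, hcoe, hcoe, coe_defect]
  exact length_torOne_add (LinearMap.exact_subtype_ker_map π) hπ hf hfg hg hφ hψ

lemma mem_negligible_iff (hπ : Function.Surjective π) (hf : Function.Injective f)
    (hfg : Function.Exact f g) (hg : Function.Surjective g)
    (hφ : f ∘ₗ φ = ψ ∘ₗ (LinearMap.ker π).subtype) (hψ : g ∘ₗ ψ = π) {eM eN eE : ℝ}
    (hM : HasET A M eM) (hN : HasET A N eN) (hE : HasET A E eE) :
    φ ∈ negligible (LinearMap.ker π) N ↔ eM + eN - eE = 0 := by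
  have ht : Tendsto (fun n : ℕ => ((dim A - 1).factorial : ℝ) / (n : ℝ) ^ (dim A - 1) *
      (defect φ n : ℝ)) atTop (𝓝 (eM + eN - eE)) := by
    refine ((hM.add hN).sub hE).congr fun n => ?_
    have h : (torLength A M n : ℝ) + torLength A N n = torLength A E n + defect φ n := by
      exact_mod_cast torLength_add hπ hf hfg hg hφ hψ n
    rw [← mul_add, ← mul_sub, h, add_sub_cancel_left]
  refine ⟨tendsto_nhds_unique ht, fun h => ?_⟩
  rwa [h] at ht

end Extension

end Asymptotics

section Pushout

variable {A : Type*} [CommRing A]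
  {L F M N : Type*} [AddCommGroup L] [Module A L] [AddCommGroup F] [Module A F]
  [AddCommGroup M] [Module A M] [AddCommGroup N] [Module A N]

/-- The pushout of `ι` and `φ`, as a quotient of `N × F`. -/
abbrev Pushout (ι : L →ₗ[A] F) (φ : L →ₗ[A] N) : Type _ :=
  (N × F) ⧸ LinearMap.range (φ.prod (-ι))

namespace Pushout

variable (ι : L →ₗ[A] F) (φ : L →ₗ[A] N)

/-- The left coprojection of the pushout. -/
def inl : N →ₗ[A] Pushout ι φ := Submodule.mkQ _ ∘ₗ LinearMap.inl A N F

/-- The right coprojection of the pushout. -/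
def inr : F →ₗ[A] Pushout ι φ := Submodule.mkQ _ ∘ₗ LinearMap.inr A N F

variable {ι} {π : F →ₗ[A] M}

/-- The map from the pushout that is `0` on `N` and `π` on `F`. -/
def toCokernel (h : π ∘ₗ ι = 0) : Pushout ι φ →ₗ[A] M :=
  Submodule.liftQ _ (π ∘ₗ LinearMap.snd A N F) <| by
    rintro _ ⟨l, rfl⟩
    simpa using LinearMap.congr_fun h l

variable {φ}

lemma mkQ_eq_zero_iff {x : N × F} :
    (LinearMap.range (φ.prod (-ι))).mkQ x = 0 ↔ ∃ l, (φ l, -ι l) = x :=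
  Submodule.Quotient.mk_eq_zero _

lemma inl_comp : inl ι φ ∘ₗ φ = inr ι φ ∘ₗ ι := by
  ext l
  rw [← sub_eq_zero]
  exact (map_sub (Submodule.mkQ _) _ _).symm.trans (mkQ_eq_zero_iff.2 ⟨l, by simp⟩)

lemma toCokernel_comp_inr (h : π ∘ₗ ι = 0) : toCokernel φ h ∘ₗ inr ι φ = π := rfl

lemma inl_injective (hι : Function.Injective ι) : Function.Injective (inl ι φ) := by
  rw [injective_iff_map_eq_zero]
  intro n hn
  obtain ⟨l, hl⟩ := mkQ_eq_zero_iff.1 hn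
  obtain ⟨rfl, hl₀⟩ := Prod.ext_iff.1 hl
  obtain rfl : l = 0 := (map_eq_zero_iff ι hι).1 (neg_eq_zero.1 hl₀)
  exact map_zero φ

lemma toCokernel_surjective (h : π ∘ₗ ι = 0) (hπ : Function.Surjective π) :
    Function.Surjective (toCokernel φ h) :=
  .of_comp (g := inr ι φ) hπ

lemma exact_inl_toCokernel (hιπ : Function.Exact ι π) :
    Function.Exact (inl ι φ) (toCokernel φ hιπ.linearMap_comp_eq_zero) := by
  intro e
  obtain ⟨⟨n, x⟩, rfl⟩ := Submodule.mkQ_surjective _ e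
  constructor
  · intro hx
    obtain ⟨l, rfl⟩ := (hιπ x).1 hx
    refine ⟨n + φ l, ?_⟩
    rw [inl, LinearMap.comp_apply, ← sub_eq_zero, ← map_sub, mkQ_eq_zero_iff]
    exact ⟨l, by simp⟩
  · rintro ⟨n', hn'⟩
    rw [← hn']
    exact map_zero π

end Pushout

end Pushout

section Ext

variable {A : Type u} [CommRing A] {F : Type u} [AddCommGroup F] [Module A F]

/-- The map `Hom(ker π, N) → Ext¹(M, N)` given by pushing out `0 → ker π → F → M → 0`. -/
def pushoutClass {M : ModuleCat.{u} A} {π : F →ₗ[A] M} (hπ : Function.Surjective π)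
    (N : ModuleCat.{u} A) : (LinearMap.ker π →ₗ[A] N) →ₗ[A] Abelian.Ext.{u} M N 1 where
  toFun φ := (LinearMap.shortExact_shortComplexKer hπ).extClass.comp
    (Abelian.Ext.mk₀ (ModuleCat.ofHom φ)) (add_zero 1)
  map_add' φ ψ := by
    rw [ModuleCat.ofHom_add, Abelian.Ext.mk₀_add, Abelian.Ext.comp_add]
  map_smul' a φ := by
    rw [show ModuleCat.ofHom (a • φ) = a • ModuleCat.ofHom φ from rfl, Abelian.Ext.mk₀_smul,
      Abelian.Ext.comp_smul, RingHom.id_apply]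

variable {M N E : ModuleCat.{u} A} {π : F →ₗ[A] M}

lemma pushoutClass_surjective [Module.Projective A F] (hπ : Function.Surjective π) :
    Function.Surjective (pushoutClass hπ N) := by
  intro α
  have : Projective π.shortComplexKer.X₂ := (IsProjective.iff_projective F).1 inferInstance
  obtain ⟨x, hx⟩ := precomp_extClass_surjective_of_projective_X₂ N
    (LinearMap.shortExact_shortComplexKer hπ) 0 α
  obtain ⟨φ, rfl⟩ := (Abelian.Ext.mk₀_bijective _ _).2 x
  exact ⟨φ.hom, hx⟩

lemma pushoutClass_eq_extClass (hπ : Function.Surjective π) {f : N ⟶ E} {g : E ⟶ M}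
    {w : f ≫ g = 0} (hS : (ShortComplex.mk f g w).ShortExact) {φ : LinearMap.ker π →ₗ[A] N}
    {ψ : F →ₗ[A] E} (hφ : f.hom ∘ₗ φ = ψ ∘ₗ (LinearMap.ker π).subtype) (hψ : g.hom ∘ₗ ψ = π) :
    pushoutClass hπ N φ = hS.extClass := by
  let τ : π.shortComplexKer ⟶ ShortComplex.mk f g w :=
    { τ₁ := ModuleCat.ofHom φ
      τ₂ := ModuleCat.ofHom ψ
      τ₃ := 𝟙 M
      comm₁₂ := ModuleCat.hom_ext hφ
      comm₂₃ := ModuleCat.hom_ext hψ }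
  have hτ := ShortComplex.ShortExact.extClass_naturality
    (LinearMap.shortExact_shortComplexKer hπ) hS τ
  exact hτ.trans (Abelian.Ext.mk₀_id_comp _)

lemma exists_pushout_square {A F M N E : Type*} [CommRing A] [AddCommGroup F] [Module A F]
    [AddCommGroup M] [Module A M] [AddCommGroup N] [Module A N] [AddCommGroup E] [Module A E]
    [Module.Projective A F] (π : F →ₗ[A] M) {f : N →ₗ[A] E} {g : E →ₗ[A] M}
    (hf : Function.Injective f) (hfg : Function.Exact f g) (hg : Function.Surjective g) :
    ∃ (φ : LinearMap.ker π →ₗ[A] N) (ψ : F →ₗ[A] E),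
      f ∘ₗ φ = ψ ∘ₗ (LinearMap.ker π).subtype ∧ g ∘ₗ ψ = π := by
  obtain ⟨ψ, hψ⟩ := Module.projective_lifting_property g π hg
  have hr : ∀ x : LinearMap.ker π, ψ x ∈ LinearMap.range f := fun x =>
    (hfg (ψ x)).1 ((LinearMap.congr_fun hψ x).trans x.2)
  refine ⟨(LinearEquiv.ofInjective f hf).symm.toLinearMap ∘ₗ
    (ψ ∘ₗ (LinearMap.ker π).subtype).codRestrict _ hr, ψ, ?_, hψ⟩
  ext x
  exact congrArg Subtype.val ((LinearEquiv.ofInjective f hf).apply_symm_apply ⟨ψ x, hr x⟩)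

end Ext

section Main

open IsLocalRing

variable {A : Type u} [CommRing A] [IsLocalRing A] [IsNoetherianRing A] {F : Type u}
  [AddCommGroup F] [Module A F] [Module.Finite A F]
  {M : ModuleCat.{u} A} {π : F →ₗ[A] M}

theorem isFiniteLength_quotient_map_negligible [Module.Projective A F] (N : ModuleCat.{u} A)
    [Module.Finite A N] (hπ : Function.Surjective π) :
    IsFiniteLength A (Abelian.Ext.{u} M N 1 ⧸
      (negligible (LinearMap.ker π) N).map (pushoutClass hπ N)) := by
  obtain ⟨k, hk⟩ := exists_defect_smul_eq_zero N (LinearMap.ker π)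
  have := Module.Finite.of_surjective _ (pushoutClass_surjective (N := N) hπ)
  refine isFiniteLength_of_pow_le_annihilator (k := k) fun a ha => Module.mem_annihilator.2 ?_
  intro x
  obtain ⟨α, rfl⟩ := Submodule.mkQ_surjective _ x
  obtain ⟨φ, rfl⟩ := pushoutClass_surjective hπ α
  rw [← map_smul, ← map_smul, Submodule.mkQ_apply, Submodule.Quotient.mk_eq_zero]
  exact Submodule.mem_map_of_mem (mem_negligible_of_defect_eq_zero (hk a ha φ))

variable {N : ModuleCat.{u} A} [Module.Finite A M] [Module.Finite A N]

lemma isTSplit_pushoutClass [Module.Flat A F] (hd : 1 ≤ dim A) (hπ : Function.Surjective π)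
    {φ : LinearMap.ker π →ₗ[A] N} (hφ : φ ∈ negligible (LinearMap.ker π) N) :
    IsTSplit (pushoutClass hπ N φ) := by
  have hιπ := LinearMap.exact_subtype_ker_map π
  let E := ModuleCat.of A (Pushout (LinearMap.ker π).subtype φ)
  let f : N →ₗ[A] E := Pushout.inl _ φ
  let g : E →ₗ[A] M := Pushout.toCokernel φ hιπ.linearMap_comp_eq_zero
  have : Module.Finite A E := inferInstanceAs (Module.Finite A (Pushout _ φ))
  have hf : Function.Injective f := Pushout.inl_injective (Submodule.subtype_injective _)
  have hfg : Function.Exact f g := Pushout.exact_inl_toCokernel hιπ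
  have hg : Function.Surjective g := Pushout.toCokernel_surjective _ hπ
  have hψ := Pushout.toCokernel_comp_inr (φ := φ) hιπ.linearMap_comp_eq_zero
  obtain ⟨eM, hM⟩ := exists_hasET hd M
  obtain ⟨eN, hN⟩ := exists_hasET hd N
  obtain ⟨eE, hE⟩ := exists_hasET hd E
  have hS := ModuleCat.shortComplex_shortExact
    (.mk (ModuleCat.ofHom f) (ModuleCat.ofHom g) (ModuleCat.hom_ext hfg.linearMap_comp_eq_zero))
    hfg hf hg
  exact ⟨E, _, _, _, hS, (pushoutClass_eq_extClass hπ hS Pushout.inl_comp hψ).symm, eM, eN, eE,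
    hM, hN, hE, (mem_negligible_iff hπ hf hfg hg Pushout.inl_comp hψ hM hN hE).1 hφ⟩

variable [Module.Projective A F]

lemma exists_mem_negligible_of_isTSplit (hπ : Function.Surjective π) {α : Abelian.Ext.{u} M N 1}
    (hα : IsTSplit α) : ∃ φ ∈ negligible (LinearMap.ker π) N, pushoutClass hπ N φ = α := by
  obtain ⟨E, f, g, w, hS, rfl, eM, eN, eE, hM, hN, hE, h₀⟩ := hα
  have hf := hS.moduleCat_injective_f
  have hg := hS.moduleCat_surjective_g
  have hfg := (ShortComplex.ShortExact.moduleCat_exact_iff_function_exact _).1 hS.exact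
  have : Module.Finite A E := .of_exact hfg hg
  obtain ⟨φ, ψ, hφ, hψ⟩ := exists_pushout_square π hf hfg hg
  exact ⟨φ, (mem_negligible_iff hπ hf hfg hg hφ hψ hM hN hE).2 h₀,
    pushoutClass_eq_extClass hπ hS hφ hψ⟩

theorem mem_map_negligible_iff_isTSplit (hd : 1 ≤ dim A) (hπ : Function.Surjective π)
    {α : Abelian.Ext.{u} M N 1} :
    α ∈ (negligible (LinearMap.ker π) N).map (pushoutClass hπ N) ↔ IsTSplit α := by
  refine ⟨?_, exists_mem_negligible_of_isTSplit hπ⟩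
  rintro ⟨φ, hφ, rfl⟩
  exact isTSplit_pushoutClass hd hπ hφ

end Main

end TSplit

end

theorem theorem4p1_general (A : Type u) [CommRing A] [IsLocalRing A] [IsNoetherianRing A]
    (hd : 1 ≤ ringKrullDim A) (M N : ModuleCat.{u} A) [Module.Finite A M] [Module.Finite A N] :
    ∃ T : Submodule A (Abelian.Ext.{u} M N 1),
      (∀ α, α ∈ T ↔ TSplit.IsTSplit α) ∧ IsFiniteLength A (Abelian.Ext.{u} M N 1 ⧸ T) := by
  have hdim : 1 ≤ TSplit.dim A := by
    rw [← TSplit.coe_dim] at hd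
    exact_mod_cast hd
  obtain ⟨F, _, _, _, _, π, hπ⟩ := Module.exists_finite_presentation A M
  exact ⟨(TSplit.negligible (LinearMap.ker π) N).map (TSplit.pushoutClass hπ N),
    fun α => TSplit.mem_map_negligible_iff_isTSplit hdim hπ,
    TSplit.isFiniteLength_quotient_map_negligible N hπ⟩

theorem theorem4p1 (A : Type u) [CommRing A] [IsLocalRing A]
    (hA : TSplit.IsCohenMacaulay A) (hd : 1 ≤ ringKrullDim A)
    (M N : ModuleCat.{u} A) (hM : TSplit.IsMCM A M) (hN : TSplit.IsMCM A N) :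
    ∃ T : Submodule A (CategoryTheory.Abelian.Ext.{u} M N 1),
      (∀ α : CategoryTheory.Abelian.Ext.{u} M N 1, α ∈ T ↔ TSplit.IsTSplit α) ∧
      IsFiniteLength A (CategoryTheory.Abelian.Ext.{u} M N 1 ⧸ T) := by
  have := hA.1
  have := hM.1
  have := hN.1
  exact theorem4p1_general A hd M N
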